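/- \textbf{Theorem (Lieb's theorem for the WVD-QOLCT).} Let $\mathbb H$ be the real quaternions with modulus $|\cdot|_Q$, let $|f|_{2,Q}=\left(\int_{\mathbb R^2}|f(x)|_Q^2\,dx\right)^{1/2}$, and let $L^2(\mathbb R^2,\mathbb H)$ be the space of measurable $f:\mathbb R^2\to\mathbb H$ with $|f|_{2,Q}<\infty$. For a quaternion $\nu$ with $\nu^2=-1$ and $A=(a,b,c,d,\tau,\eta)\in\mathbb R^6$ with $ad-bc=1$ and $b\neq 0$, put $$K_A^{\nu}(s,v)=\frac{1}{\sqrt{2\pi\nu b}}\;\exp\!\left(\nu\,\frac{a s^2-2s(v-\tau)-2v(d\tau-b\eta)+d(v^2+\tau^2)}{2b}\right),\qquad s,v\in\mathbb R,$$ where $\frac{1}{\sqrt{2\pi\nu b}}$ denotes $\frac{e^{-\operatorname{sgn}(b)\nu\pi/4}}{\sqrt{2\pi|b|}}$. Given quaternions $\lambda,\mu$ with $\lambda^2=\mu^2=-1$, parameters $A_l=(a_l,b_l,c_l,d_l,\tau_l,\eta_l)\in\mathbb R^6$ with $a_ld_l-b_lc_l=1$ and $b_l\ne0$ ($l=1,2$),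 and $f,g\in L^2(\mathbb R^2,\mathbb H)$, the Wigner--Ville distribution associated with the two-sided quaternionic offset linear canonical transform is $$\mathcal W_{f,g}^{A_1,A_2}(t,u)=\int_{\mathbb R^2}K_{A_1}^{\lambda}(s_1,u_1)\,f\!\left(t+\tfrac s2\right)\overline{g\!\left(t-\tfrac s2\right)}\,K_{A_2}^{\mu}(s_2,u_2)\,ds,\qquad t,u\in\mathbb R^2.$$ For every $2\le p<\infty$ there is a constant $C=C(p)>0$, depending only on $p$, such that for all such $\lambda,\mu,A_1,A_2$ and all $f,g\in L^2(\mathbb R^2,\mathbb H)$: the integral defining $\mathcal W_{f,g}^{A_1,A_2}(t,u)$ converges absolutely for all $t,u\in\mathbb R^2$, the function $(t,u)\mapsto|\mathcal W_{f,g}^{A_1,A_2}(t,u)|_Q^p$ is integrable on $\mathbb R^2\times\mathbb R^2$, and $$\int_{\mathbb R^2}\int_{\mathbb R^2}\left|\mathcal W_{f,g}^{A_1,A_2}(t,u)\right|_Q^p\,du\,dt\;\le\; C\,\frac{|b_1b_2|^{-\frac p2+1}}{(2\pi)^p}\,|f|_{2,Q}^p\,|g|_{2,Q}^p .$$ -/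

import Mathlib

open MeasureTheory
open scoped Quaternion

/-- The real parameters `a, b, c, d, τ, η` with `a d - b c = 1` of an offset linear canonical
transform in one variable. -/
structure OffsetMatrix where
  a : ℝ
  b : ℝ
  c : ℝ
  d : ℝ
  τ : ℝ
  η : ℝ
  det_eq_one : a * d - b * c = 1

/-- The one-variable kernel `K_A^ν(s, v)` of the offset linear canonical transform, for `b ≠ 0` and
a quaternion `ν` with `ν² = -1`. The factor `1 / √(ν 2π b)` is the principal value
`e^{-sgn(b) ν π/4} / √(2π|b|)`. -/
noncomputable def offsetKernel (ν : ℍ[ℝ]) (A : OffsetMatrix) (s v : ℝ) : ℍ[ℝ] :=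
  (1 / Real.sqrt (2 * Real.pi * |A.b|)) •
    (NormedSpace.exp ((-(SignType.sign A.b : ℝ) * (Real.pi / 4)) • ν) *
      NormedSpace.exp
        (((A.a * s ^ 2 - 2 * s * (v - A.τ) - 2 * v * (A.d * A.τ - A.b * A.η)
            + A.d * (v ^ 2 + A.τ ^ 2)) / (2 * A.b)) • ν))

/-- The function `s ↦ K_{A₁}^lam(s₁, u₁) f(t + s/2) conj(g(t - s/2)) K_{A₂}^mu(s₂, u₂)`. -/
noncomputable def wvdIntegrand (lam mu : ℍ[ℝ]) (A₁ A₂ : OffsetMatrix) (f g : ℝ × ℝ → ℍ[ℝ])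
    (t u s : ℝ × ℝ) : ℍ[ℝ] :=
  offsetKernel lam A₁ s.1 u.1 *
    (f (t + (1 / 2 : ℝ) • s) * star (g (t - (1 / 2 : ℝ) • s))) *
      offsetKernel mu A₂ s.2 u.2

/-- The Wigner-Ville distribution associated with the two-sided quaternionic offset linear
canonical transform, for `A₁.b ≠ 0` and `A₂.b ≠ 0`. -/
noncomputable def wvdQOLCT (lam mu : ℍ[ℝ]) (A₁ A₂ : OffsetMatrix) (f g : ℝ × ℝ → ℍ[ℝ])
    (t u : ℝ × ℝ) : ℍ[ℝ] :=
  ∫ s : ℝ × ℝ, wvdIntegrand lam mu A₁ A₂ f g t u s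

/-- The norm `|f|_{2,Q} = (∫ |f(x)|² dx)^{1/2}` of a square-integrable quaternion-valued signal. -/
noncomputable def quatL2Norm (f : ℝ × ℝ → ℍ[ℝ]) : ℝ :=
  Real.sqrt (∫ x : ℝ × ℝ, ‖f x‖ ^ 2)

/-! The exponent `p` interpolates between `∞` and `2`: if `M` bounds `‖W‖` everywhere, then `‖W‖ ^ p
≤ M ^ (p - 2) * ‖W‖ ^ 2`. The sup bound (`norm_wvdQOLCT_le`) is Cauchy–Schwarz, since the kernels
have constant modulus. For the `L²` bound (`lintegral_enorm_sq_wvdQOLCT_le`), each kernel factors as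
a Fourier kernel between unimodular chirps. So for fixed `t` the distribution is, up to factors of
known modulus, a two-sided quaternionic Fourier transform of the cross product of `f` and `g`.
Integrating over `t` gives the product of the two `L²` norms by Tonelli. The two-sided transform is
reduced to a one-sided one by splitting `k` into `(k ± lam k mu) / 2`: on each piece, right
multiplication by `mu` is left multiplication by `∓lam`, so both exponentials merge on the left. The
one-sided transform is four complex transforms, one per real coordinate of `k`, to which Plancherel
applies. Constants are not sharp; only their dependence on `p` alone matters. -/

/-! ### Complex Plancherel on `L¹ ∩ L²`. -/

section Plancherel
open FourierTransform SchwartzMap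
open scoped ENNReal

/-- **Plancherel's theorem** for the integral Fourier transform on `L¹ ∩ L²`. -/
theorem eLpNorm_fourier_eq_of_integrable_of_memLp {V : Type*} [NormedAddCommGroup V]
    [InnerProductSpace ℝ V] [FiniteDimensional ℝ V] [MeasurableSpace V] [BorelSpace V]
    {φ : V → ℂ} (h1 : Integrable φ) (h2 : MemLp φ 2) :
    eLpNorm (𝓕 φ) 2 volume = eLpNorm φ 2 volume := by
  set F : Lp ℂ 2 (volume : Measure V) := h2.toLp φ with hF
  have hcont : Continuous (𝓕 φ) :=
    VectorFourier.fourierIntegral_continuous Real.continuous_fourierChar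
      (by exact continuous_inner) h1
  -- The integral transform and the `L²` transform agree as distributions: against a test function,
  -- both move the transform onto it.
  have hae : ∀ᵐ x : V, 𝓕 φ x = (𝓕 F : Lp ℂ 2 (volume : Measure V)) x := by
    refine ae_eq_of_integral_contDiff_smul_eq (hcont.locallyIntegrable)
      ((Lp.memLp (𝓕 F)).locallyIntegrable (by norm_num)) ?_
    intro g hg hgc
    have hgC : ContDiff ℝ ((⊤ : ℕ∞) : WithTop ℕ∞) (fun x => (g x : ℂ)) := Complex.ofRealCLM.contDiff.comp hg
    have hgCc : HasCompactSupport (fun x => (g x : ℂ)) := hgc.comp_left (g := Complex.ofReal) (by simp)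
    let ψ : 𝓢(V, ℂ) := hgCc.toSchwartzMap hgC
    have hψ : ∀ x, ψ x = (g x : ℂ) := fun x => rfl
    have key := congrArg (fun T : 𝓢'(V, ℂ) => T ψ) (Lp.fourier_toTemperedDistribution_eq F)
    simp only [TemperedDistribution.fourier_apply, Lp.toTemperedDistribution_apply] at key
    have hfl := VectorFourier.integral_fourierIntegral_smul_eq_flip (μ := volume) (ν := volume)
      (L := innerₗ V) (f := φ) (g := ψ) Real.continuous_fourierChar
      (by exact continuous_inner) h1 ψ.integrable
    have e1 : ∫ x, g x • 𝓕 φ x = ∫ x, 𝓕 φ x • ψ x := by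
      congr with x; simp [hψ, mul_comm]
    have e2 : ∫ x, g x • (𝓕 F : Lp ℂ 2 (volume : Measure V)) x
        = ∫ x, ψ x • (𝓕 F : Lp ℂ 2 (volume : Measure V)) x := by
      rfl
    rw [e1, e2, ← key]
    refine hfl.trans ?_
    refine integral_congr_ae ?_
    filter_upwards [h2.coeFn_toLp] with x hx
    rw [hF, hx, flip_innerₗ, SchwartzMap.fourier_coe, smul_eq_mul, smul_eq_mul, mul_comm]
    rfl
  rw [eLpNorm_congr_ae hae]
  have := Lp.norm_fourier_eq F
  rw [Lp.norm_def, Lp.norm_def, ENNReal.toReal_eq_toReal_iff' (Lp.eLpNorm_ne_top _)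
    (Lp.eLpNorm_ne_top _)] at this
  rw [this]
  exact eLpNorm_congr_ae h2.coeFn_toLp

/-- Plancherel's theorem for a square-integrable function on the plane, with its kernel written in
coordinates. -/
theorem lintegral_enorm_sq_fourier_prod {φ : ℝ × ℝ → ℂ} (h1 : Integrable φ) (h2 : MemLp φ 2) :
    ∫⁻ w : ℝ × ℝ, ‖∫ s : ℝ × ℝ,
        Complex.exp ((-(2 * Real.pi * (s.1 * w.1 + s.2 * w.2)) : ℝ) * Complex.I) * φ s‖ₑ ^ 2
      = ∫⁻ s, ‖φ s‖ₑ ^ 2 := by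
  -- `ℝ × ℝ` carries the sup norm, so the inner-product statement is transported from `WithLp 2 (ℝ ×
  -- ℝ)`.
  have mp := WithLp.volume_preserving_ofLp ℝ ℝ
  have mp' := WithLp.volume_preserving_toLp ℝ ℝ
  have emb : MeasurableEmbedding (@WithLp.ofLp 2 (ℝ × ℝ)) :=
    (MeasurableEquiv.toLp 2 (ℝ × ℝ)).symm.measurableEmbedding
  have emb' : MeasurableEmbedding (@WithLp.toLp 2 (ℝ × ℝ)) :=
    (MeasurableEquiv.toLp 2 (ℝ × ℝ)).measurableEmbedding
  have H := eLpNorm_fourier_eq_of_integrable_of_memLp (V := WithLp 2 (ℝ × ℝ))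
    (φ := φ ∘ WithLp.ofLp) ((mp.integrable_comp_emb emb).2 h1) (h2.comp_measurePreserving mp)
  have e : ∀ (X : WithLp 2 (ℝ × ℝ) → ℂ), eLpNorm X 2 volume ^ 2 = ∫⁻ x, ‖X x‖ₑ ^ 2 := by
    intro X
    rw [← ENNReal.rpow_ofNat]
    simpa using eLpNorm_nnreal_pow_eq_lintegral (f := X) (p := 2) (μ := volume) (by norm_num)
  have H2 := congrArg (· ^ 2) H
  simp only [e] at H2
  rw [← mp.lintegral_comp_emb emb, ← mp.lintegral_comp_emb emb]
  rw [Function.comp_def] at H2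
  rw [← H2]
  refine lintegral_congr fun w => ?_
  congr 2
  rw [Real.fourier_eq', ← mp'.integral_comp emb']
  refine integral_congr_ae (Filter.Eventually.of_forall fun s => ?_)
  simp only [WithLp.prod_inner_apply, smul_eq_mul]
  congr 3
  push_cast
  simp
  ring

end Plancherel

/-! ### Exponentials along a square root of `-1`. -/

section QuaternionExponential

theorem Complex.norm_lift_quaternion {ν : ℍ[ℝ]} (h : ν * ν = -1) (z : ℂ) :
    ‖Complex.lift ⟨ν, h⟩ z‖ = ‖z‖ := by
  have h1 := congrArg QuaternionAlgebra.re h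
  have h2 := congrArg QuaternionAlgebra.imI h
  have h3 := congrArg QuaternionAlgebra.imJ h
  have h4 := congrArg QuaternionAlgebra.imK h
  simp at h1 h2 h3 h4
  -- The imaginary part of `ν²` is `2 ν.re` times that of `ν`; if `ν.re ≠ 0`, then `ν` is real and
  -- its square cannot be `-1`.
  have hre : ν.re = 0 := by
    by_contra hne
    have e2 : ν.imI = 0 := by
      have : ν.re * ν.imI = 0 := by linarith
      simpa [hne] using this
    have e3 : ν.imJ = 0 := by
      have : ν.re * ν.imJ = 0 := by linarith
      simpa [hne] using this
    have e4 : ν.imK = 0 := by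
      have : ν.re * ν.imK = 0 := by linarith
      simpa [hne] using this
    rw [e2, e3, e4] at h1
    nlinarith [mul_self_nonneg ν.re]
  rw [← sq_eq_sq₀ (norm_nonneg _) (norm_nonneg _), sq, ← Quaternion.normSq_eq_norm_mul_self,
    Complex.sq_norm, Complex.normSq_apply, Quaternion.normSq_def']
  simp [Complex.liftAux_apply, hre]
  rw [hre] at h1
  linear_combination (-(z.im ^ 2)) * h1

theorem Complex.continuous_lift_quaternion {ν : ℍ[ℝ]} (h : ν * ν = -1) :
    Continuous (Complex.lift ⟨ν, h⟩ : ℂ →ₐ[ℝ] ℍ[ℝ]) :=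
  (Complex.lift ⟨ν, h⟩ : ℂ →ₐ[ℝ] ℍ[ℝ]).toLinearMap.continuous_of_finiteDimensional

variable {ν : ℍ[ℝ]}

theorem Quaternion.exp_smul_eq_lift (h : ν * ν = -1) (θ : ℝ) :
    NormedSpace.exp (θ • ν) = Complex.lift ⟨ν, h⟩ (Complex.exp (θ * Complex.I)) := by
  rw [Complex.exp_eq_exp_ℂ, NormedSpace.map_exp _ (Complex.continuous_lift_quaternion h)]
  congr 1
  simp [Complex.liftAux_apply]

theorem Quaternion.norm_exp_smul (h : ν * ν = -1) (θ : ℝ) :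
    ‖NormedSpace.exp (θ • ν)‖ = 1 := by
  rw [Quaternion.exp_smul_eq_lift h, Complex.norm_lift_quaternion, Complex.norm_exp_ofReal_mul_I]

theorem Quaternion.exp_smul_eq_cos_add_sin (h : ν * ν = -1) (θ : ℝ) :
    NormedSpace.exp (θ • ν) = (Real.cos θ : ℍ[ℝ]) + Real.sin θ • ν := by
  rw [Quaternion.exp_smul_eq_lift h]
  simp [Complex.liftAux_apply, Complex.exp_ofReal_mul_I_re, Complex.exp_ofReal_mul_I_im]

theorem Quaternion.exp_add_smul (h : ν * ν = -1) (θ θ' : ℝ) :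
    NormedSpace.exp ((θ + θ') • ν) = NormedSpace.exp (θ • ν) * NormedSpace.exp (θ' • ν) := by
  simp only [Quaternion.exp_smul_eq_lift h]
  rw [← map_mul, ← Complex.exp_add]
  push_cast
  ring_nf

theorem Quaternion.continuous_exp_smul (h : ν * ν = -1) :
    Continuous fun θ : ℝ => NormedSpace.exp (θ • ν) := by
  simp only [Quaternion.exp_smul_eq_lift h]
  exact (Complex.continuous_lift_quaternion h).comp (by fun_prop)

/-- Cosine is even and sine is odd, so the sign `σ` passes into the angle. This carries a right
exponential to the left. -/
theorem Quaternion.mul_exp_smul_of_mul_eq {μ q : ℍ[ℝ]} {σ : ℝ} (hν : ν * ν = -1) (hμ : μ * μ = -1)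
    (hσ : σ = 1 ∨ σ = -1) (hq : q * μ = σ • (ν * q)) (θ : ℝ) :
    q * NormedSpace.exp (θ • μ) = NormedSpace.exp ((σ * θ) • ν) * q := by
  rw [Quaternion.exp_smul_eq_cos_add_sin hν, Quaternion.exp_smul_eq_cos_add_sin hμ, mul_add,
    add_mul, mul_smul_comm, hq, ← Quaternion.coe_commutes, smul_mul_assoc, smul_smul]
  rcases hσ with rfl | rfl <;> simp

end QuaternionExponential

/-! ### `L²` bounds for one- and two-sided quaternionic Fourier transforms. -/

section QuaternionFourier
open scoped ENNReal

/-- The one-sided quaternionic Fourier transform on the plane is bounded on `L²`. -/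
theorem lintegral_enorm_sq_quaternion_fourier_le {ν : ℍ[ℝ]} (hν : ν * ν = -1)
    {k : ℝ × ℝ → ℍ[ℝ]} (hk : Integrable k) :
    ∫⁻ w : ℝ × ℝ, ‖∫ s : ℝ × ℝ,
        NormedSpace.exp ((-(2 * Real.pi * (s.1 * w.1 + s.2 * w.2))) • ν) * k s‖ₑ ^ 2
      ≤ 4 * ∫⁻ s, ‖k s‖ₑ ^ 2 := by
  by_cases htop : ∫⁻ s, ‖k s‖ₑ ^ 2 = ∞
  · simp [htop]
  have hk2 : MemLp k 2 := by
    refine ⟨hk.1, ?_⟩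
    rw [eLpNorm_lt_top_iff_lintegral_rpow_enorm_lt_top (by norm_num) (by norm_num)]
    simpa using lt_top_iff_ne_top.2 htop
  let b := stdOrthonormalBasis ℝ ℍ[ℝ]
  let φ : Fin (Module.finrank ℝ ℍ[ℝ]) → ℝ × ℝ → ℂ := fun i s => ((inner ℝ (b i) (k s) : ℝ) : ℂ)
  let G : Fin (Module.finrank ℝ ℍ[ℝ]) → ℝ × ℝ → ℂ := fun i w =>
    ∫ s : ℝ × ℝ, Complex.exp ((-(2 * Real.pi * (s.1 * w.1 + s.2 * w.2)) : ℝ) * Complex.I) * φ i s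
  have hφ1 : ∀ i, Integrable (φ i) := fun i => (hk.const_inner (b i)).ofReal
  have hφ2 : ∀ i, MemLp (φ i) 2 := fun i => (hk2.const_inner (b i)).ofReal
  have hφint : ∀ (i) (w : ℝ × ℝ), Integrable fun s : ℝ × ℝ =>
      Complex.exp ((-(2 * Real.pi * (s.1 * w.1 + s.2 * w.2)) : ℝ) * Complex.I) * φ i s := by
    intro i w
    refine (hφ1 i).bdd_mul (c := 1) (Continuous.aestronglyMeasurable (by fun_prop))
      (Filter.Eventually.of_forall fun s => ?_)
    rw [Complex.norm_exp_ofReal_mul_I]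
  have hGm : ∀ i, AEStronglyMeasurable (G i) volume := by
    intro i
    refine AEStronglyMeasurable.integral_prod_right' (f := fun z : (ℝ × ℝ) × (ℝ × ℝ) =>
      Complex.exp ((-(2 * Real.pi * (z.2.1 * z.1.1 + z.2.2 * z.1.2)) : ℝ) * Complex.I) * φ i z.2) ?_
    exact (Continuous.aestronglyMeasurable (by fun_prop)).mul (hφ1 i).1.comp_snd
  have hsum : ∀ w, ∫ s : ℝ × ℝ,
      NormedSpace.exp ((-(2 * Real.pi * (s.1 * w.1 + s.2 * w.2))) • ν) * k s
        = ∑ i, Complex.lift ⟨ν, hν⟩ (G i w) * b i := by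
    intro w
    let T : Fin (Module.finrank ℝ ℍ[ℝ]) → ℂ →L[ℝ] ℍ[ℝ] := fun i =>
      LinearMap.toContinuousLinearMap
        ((LinearMap.mulRight ℝ (b i)).comp (Complex.lift ⟨ν, hν⟩ : ℂ →ₐ[ℝ] ℍ[ℝ]).toLinearMap)
    have hT : ∀ i z, T i z = Complex.lift ⟨ν, hν⟩ z * b i := fun i z => rfl
    calc _ = ∫ s : ℝ × ℝ, ∑ i, T i
          (Complex.exp ((-(2 * Real.pi * (s.1 * w.1 + s.2 * w.2)) : ℝ) * Complex.I) * φ i s) := by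
          refine integral_congr_ae (Filter.Eventually.of_forall fun s => ?_)
          simp only [hT, map_mul, Quaternion.exp_smul_eq_lift hν, mul_assoc, ← Finset.mul_sum]
          congr 1
          conv_lhs => rw [← b.sum_repr' (k s)]
          refine Finset.sum_congr rfl fun i _ => ?_
          simp [φ, Algebra.smul_def]
      _ = ∑ i, T i (G i w) := by
          rw [integral_finsetSum _ fun i _ => (T i).integrable_comp (hφint i w)]
          exact Finset.sum_congr rfl fun i _ => (T i).integral_comp_comm (hφint i w)
      _ = _ := rfl
  have hpt : ∀ w, ‖∫ s : ℝ × ℝ,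
      NormedSpace.exp ((-(2 * Real.pi * (s.1 * w.1 + s.2 * w.2))) • ν) * k s‖ₑ ^ 2
        ≤ 4 * ∑ i, ‖G i w‖ₑ ^ 2 := by
    intro w
    rw [hsum]
    -- The four products need not be orthogonal, so Cauchy–Schwarz is used, at the cost of a factor
    -- `4 = dim ℍ`.
    have : ‖∑ i, Complex.lift ⟨ν, hν⟩ (G i w) * b i‖ ^ 2 ≤ 4 * ∑ i, ‖G i w‖ ^ 2 := by
      calc _ ≤ (∑ i, ‖G i w‖) ^ 2 := by
            gcongr
            refine (norm_sum_le _ _).trans (Finset.sum_le_sum fun i _ => ?_)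
            rw [norm_mul, Complex.norm_lift_quaternion, b.orthonormal.1 i, mul_one]
        _ ≤ _ := by
            have := sq_sum_le_card_mul_sum_sq (s := Finset.univ) (f := fun i => ‖G i w‖)
            simpa [Quaternion.finrank_eq_four] using this
    have := ENNReal.ofReal_le_ofReal this
    rw [ENNReal.ofReal_mul (by norm_num), ENNReal.ofReal_sum_of_nonneg fun i _ => by positivity,
      ENNReal.ofReal_pow (norm_nonneg _), ofReal_norm] at this
    simpa only [ENNReal.ofReal_pow (norm_nonneg _), ofReal_norm, ENNReal.ofReal_ofNat] using this
  refine (lintegral_mono hpt).trans_eq ?_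
  rw [lintegral_const_mul' _ _ (by norm_num),
    lintegral_finsetSum' _ fun i _ => (hGm i).enorm.pow_const 2]
  congr 1
  simp only [G, lintegral_enorm_sq_fourier_prod (hφ1 _) (hφ2 _)]
  rw [← lintegral_finsetSum' _ fun i _ => (hφ1 i).1.enorm.pow_const 2]
  refine lintegral_congr fun s => ?_
  have := b.sum_sq_norm_inner_right (k s)
  have := congrArg ENNReal.ofReal this
  rw [ENNReal.ofReal_sum_of_nonneg fun i _ => by positivity] at this
  simp only [ENNReal.ofReal_pow (norm_nonneg _), ofReal_norm] at this
  rw [← this]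
  refine Finset.sum_congr rfl fun i _ => ?_
  simp only [φ]
  rw [← ofReal_norm, ← ofReal_norm, Complex.norm_real]

theorem lintegral_comp_mul_mul {c₁ c₂ : ℝ} (h₁ : c₁ ≠ 0) (h₂ : c₂ ≠ 0) (F : ℝ × ℝ → ℝ≥0∞) :
    ∫⁻ u : ℝ × ℝ, F (c₁ * u.1, c₂ * u.2)
      = ENNReal.ofReal (|c₁⁻¹| * |c₂⁻¹|) * ∫⁻ w, F w := by
  have emb : MeasurableEmbedding (Prod.map (fun x : ℝ => c₁ * x) fun x : ℝ => c₂ * x) :=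
    (((Homeomorph.mulLeft₀ c₁ h₁).prodCongr
      (Homeomorph.mulLeft₀ c₂ h₂)).toMeasurableEquiv).measurableEmbedding
  have := emb.lintegral_map (μ := volume) F
  rw [Measure.volume_eq_prod, ← Measure.map_prod_map _ _ (by fun_prop) (by fun_prop),
    Real.map_volume_mul_left h₁, Real.map_volume_mul_left h₂, Measure.prod_smul_left,
    Measure.prod_smul_right, smul_smul, lintegral_smul_measure, ← ENNReal.ofReal_mul (abs_nonneg _)] at this
  exact this.symm

theorem lintegral_enorm_sq_quaternion_fourier_scaled_le {ν : ℍ[ℝ]} (hν : ν * ν = -1)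
    {b₁ b₂ : ℝ} (hb₁ : b₁ ≠ 0) (hb₂ : b₂ ≠ 0) {k : ℝ × ℝ → ℍ[ℝ]} (hk : Integrable k) :
    ∫⁻ u : ℝ × ℝ, ‖∫ s : ℝ × ℝ,
        NormedSpace.exp ((-(s.1 * u.1 / b₁ + s.2 * u.2 / b₂)) • ν) * k s‖ₑ ^ 2
      ≤ ENNReal.ofReal (16 * Real.pi ^ 2 * |b₁ * b₂|) * ∫⁻ s, ‖k s‖ₑ ^ 2 := by
  have hpi := Real.pi_pos
  have h := lintegral_comp_mul_mul (c₁ := (2 * Real.pi * b₁)⁻¹) (c₂ := (2 * Real.pi * b₂)⁻¹)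
    (by positivity) (by positivity) fun w => ‖∫ s : ℝ × ℝ,
        NormedSpace.exp ((-(2 * Real.pi * (s.1 * w.1 + s.2 * w.2))) • ν) * k s‖ₑ ^ 2
  have e : ∀ u s : ℝ × ℝ, 2 * Real.pi * (s.1 * ((2 * Real.pi * b₁)⁻¹ * u.1)
      + s.2 * ((2 * Real.pi * b₂)⁻¹ * u.2)) = s.1 * u.1 / b₁ + s.2 * u.2 / b₂ := by
    intro u s
    field_simp
  simp only [e] at h
  rw [h]
  refine (mul_le_mul_right (lintegral_enorm_sq_quaternion_fourier_le hν hk) _).trans_eq ?_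
  rw [← mul_assoc, inv_inv, inv_inv, show (4 : ℝ≥0∞) = ENNReal.ofReal 4 by simp,
    ← ENNReal.ofReal_mul (by positivity)]
  congr 2
  simp only [abs_mul, abs_of_pos hpi, Nat.abs_ofNat]
  ring

/-- The two-sided quaternionic Fourier transform on the plane is bounded on `L²`. -/
theorem lintegral_enorm_sq_two_sided_quaternion_fourier_le {lam mu : ℍ[ℝ]} (hl : lam * lam = -1)
    (hm : mu * mu = -1) {b₁ b₂ : ℝ} (hb₁ : b₁ ≠ 0) (hb₂ : b₂ ≠ 0) {k : ℝ × ℝ → ℍ[ℝ]}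
    (hk : Integrable k) :
    ∫⁻ u : ℝ × ℝ, ‖∫ s : ℝ × ℝ, NormedSpace.exp ((-(s.1 * u.1 / b₁)) • lam) * k s *
        NormedSpace.exp ((-(s.2 * u.2 / b₂)) • mu)‖ₑ ^ 2
      ≤ ENNReal.ofReal (64 * Real.pi ^ 2 * |b₁ * b₂|) * ∫⁻ s, ‖k s‖ₑ ^ 2 := by
  have hnl : ‖lam‖ = 1 := by
    have := congrArg norm hl
    rw [norm_mul, norm_neg, norm_one] at this
    nlinarith [norm_nonneg lam]
  have hnm : ‖mu‖ = 1 := by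
    have := congrArg norm hm
    rw [norm_mul, norm_neg, norm_one] at this
    nlinarith [norm_nonneg mu]
  -- The two pieces `P 1`, `P (-1)` sum to `k` and intertwine `mu` with `∓lam`.
  let P : ℝ → (ℝ × ℝ) → ℍ[ℝ] := fun σ s => (1 / 2 : ℝ) • (k s + σ • (lam * k s * mu))
  have hP : ∀ σ, Integrable (P σ) := fun σ =>
    Integrable.smul (1 / 2 : ℝ) (hk.add (((hk.const_mul lam).mul_const mu).smul σ))
  have hPle : ∀ σ : ℝ, |σ| = 1 → ∀ s, ‖P σ s‖ₑ ≤ ‖k s‖ₑ := by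
    intro σ hσ s
    refine enorm_le_iff_norm_le.2 ?_
    have : ‖k s + σ • (lam * k s * mu)‖ ≤ ‖k s‖ + ‖k s‖ := by
      refine (norm_add_le _ _).trans_eq ?_
      rw [norm_smul, norm_mul, norm_mul, hnl, hnm, Real.norm_eq_abs, hσ]
      ring
    simp only [P, norm_smul]
    norm_num
    linarith
  have hPmul : ∀ σ : ℝ, (σ = 1 ∨ σ = -1) → ∀ s, P σ s * mu = (-σ) • (lam * P σ s) := by
    intro σ hσ s
    simp only [P, smul_mul_assoc, mul_smul_comm, add_mul, mul_add, mul_assoc, hm]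
    simp only [← mul_assoc, hl]
    rcases hσ with rfl | rfl <;> simp [add_comm]
  have hPsum : ∀ s, k s = P 1 s + P (-1) s := by
    intro s
    simp only [P, ← smul_add]
    module
  -- The sign from the intertwining is absorbed into the scale `-σ * b₂`, which has the same
  -- absolute value as `b₂`.
  have hterm : ∀ σ : ℝ, (σ = 1 ∨ σ = -1) → ∀ u s : ℝ × ℝ,
      NormedSpace.exp ((-(s.1 * u.1 / b₁)) • lam) * P σ s *
        NormedSpace.exp ((-(s.2 * u.2 / b₂)) • mu)
      = NormedSpace.exp ((-(s.1 * u.1 / b₁ + s.2 * u.2 / (-σ * b₂))) • lam) * P σ s := by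
    intro σ hσ u s
    rw [mul_assoc, Quaternion.mul_exp_smul_of_mul_eq hl hm (σ := -σ) (by rcases hσ with rfl | rfl <;> simp)
      (hPmul σ hσ s), ← mul_assoc, ← Quaternion.exp_add_smul hl]
    congr 3
    rcases hσ with rfl | rfl <;> field_simp <;> ring
  have hint : ∀ (σ : ℝ) (u : ℝ × ℝ) (c : ℝ), Integrable fun s : ℝ × ℝ =>
      NormedSpace.exp ((-(s.1 * u.1 / b₁ + s.2 * u.2 / c)) • lam) * P σ s := by
    intro σ u c
    refine (hP σ).bdd_mul (c := 1) (Continuous.aestronglyMeasurable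
      ((Quaternion.continuous_exp_smul hl).comp (by fun_prop)))
      (Filter.Eventually.of_forall fun s => ?_)
    rw [Quaternion.norm_exp_smul hl]
  let J : ℝ → (ℝ × ℝ) → ℍ[ℝ] := fun σ u => ∫ s : ℝ × ℝ,
    NormedSpace.exp ((-(s.1 * u.1 / b₁ + s.2 * u.2 / (-σ * b₂))) • lam) * P σ s
  have hJ : ∀ σ : ℝ, (σ = 1 ∨ σ = -1) → ∫⁻ u, ‖J σ u‖ₑ ^ 2
      ≤ ENNReal.ofReal (16 * Real.pi ^ 2 * |b₁ * b₂|) * ∫⁻ s, ‖k s‖ₑ ^ 2 := by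
    intro σ hσ
    have hσ' : |σ| = 1 := by rcases hσ with rfl | rfl <;> simp
    have hσ0 : σ ≠ 0 := by rintro rfl; simp at hσ'
    refine (lintegral_enorm_sq_quaternion_fourier_scaled_le hl hb₁
      (mul_ne_zero (neg_ne_zero.2 hσ0) hb₂) (hP σ)).trans ?_
    rw [show |b₁ * (-σ * b₂)| = |b₁ * b₂| by simp [abs_mul, hσ']]
    gcongr with s
    exact hPle σ hσ' s
  have hJm : AEStronglyMeasurable (J 1) volume := by
    refine AEStronglyMeasurable.integral_prod_right' (f := fun z : (ℝ × ℝ) × (ℝ × ℝ) =>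
      NormedSpace.exp ((-(z.2.1 * z.1.1 / b₁ + z.2.2 * z.1.2 / (-1 * b₂))) • lam) * P 1 z.2) ?_
    exact (Continuous.aestronglyMeasurable
      ((Quaternion.continuous_exp_smul hl).comp (by fun_prop))).mul (hP 1).1.comp_snd
  have hpt : ∀ u : ℝ × ℝ, ‖∫ s : ℝ × ℝ, NormedSpace.exp ((-(s.1 * u.1 / b₁)) • lam) * k s *
        NormedSpace.exp ((-(s.2 * u.2 / b₂)) • mu)‖ₑ ^ 2
      ≤ 2 * (‖J 1 u‖ₑ ^ 2 + ‖J (-1) u‖ₑ ^ 2) := by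
    intro u
    have e : ∫ s : ℝ × ℝ, NormedSpace.exp ((-(s.1 * u.1 / b₁)) • lam) * k s *
        NormedSpace.exp ((-(s.2 * u.2 / b₂)) • mu) = J 1 u + J (-1) u := by
      simp only [J]
      rw [← integral_add (hint _ _ _) (hint _ _ _)]
      refine integral_congr_ae (Filter.Eventually.of_forall fun s => ?_)
      simp only [← hterm 1 (Or.inl rfl), ← hterm (-1) (Or.inr rfl), ← add_mul, ← mul_add, ← hPsum]
    rw [e]
    have h2 : ‖J 1 u + J (-1) u‖ ^ 2 ≤ 2 * (‖J 1 u‖ ^ 2 + ‖J (-1) u‖ ^ 2) := by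
      have := norm_add_le (J 1 u) (J (-1) u)
      nlinarith [sq_nonneg (‖J 1 u‖ - ‖J (-1) u‖), norm_nonneg (J 1 u + J (-1) u)]
    have h3 := ENNReal.ofReal_le_ofReal h2
    rw [ENNReal.ofReal_mul (by norm_num), ENNReal.ofReal_add (by positivity) (by positivity)] at h3
    simpa only [ENNReal.ofReal_pow (norm_nonneg _), ofReal_norm, ENNReal.ofReal_ofNat] using h3
  refine (lintegral_mono hpt).trans ?_
  rw [lintegral_const_mul' _ _ (by norm_num), lintegral_add_left' (hJm.enorm.pow_const 2)]
  refine (mul_le_mul_right (add_le_add (hJ 1 (Or.inl rfl)) (hJ (-1) (Or.inr rfl))) _).trans_eq ?_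
  rw [← two_mul, ← mul_assoc, ← mul_assoc, show (2 : ℝ≥0∞) = ENNReal.ofReal 2 by simp,
    ← ENNReal.ofReal_mul (by norm_num), ← ENNReal.ofReal_mul (by norm_num)]
  congr 2
  ring

end QuaternionFourier

/-! ### Factorization and modulus of the kernel. -/

section OffsetKernel

variable {ν : ℍ[ℝ]}

/-- The kernel is a Fourier kernel between chirps in `v` and in `s`. -/
theorem exists_offsetKernel_eq (h : ν * ν = -1) (A : OffsetMatrix) :
    ∃ κ χ : ℝ → ℝ, Continuous χ ∧ (A.b ≠ 0 → ∀ s v, offsetKernel ν A s v =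
      (1 / Real.sqrt (2 * Real.pi * |A.b|)) • (NormedSpace.exp (κ v • ν) *
        NormedSpace.exp ((-(s * v / A.b)) • ν) * NormedSpace.exp (χ s • ν))) := by
  -- The constant phase goes into `κ`.
  refine ⟨fun v => -(SignType.sign A.b : ℝ) * (Real.pi / 4) +
    (-(2 * v * (A.d * A.τ - A.b * A.η)) + A.d * (v ^ 2 + A.τ ^ 2)) / (2 * A.b),
    fun s => (A.a * s ^ 2 + 2 * s * A.τ) / (2 * A.b), by fun_prop, ?_⟩
  intro hb s v
  rw [offsetKernel, ← Quaternion.exp_add_smul h, ← Quaternion.exp_add_smul h,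
    ← Quaternion.exp_add_smul h]
  congr 3
  field_simp
  ring

theorem norm_offsetKernel (h : ν * ν = -1) (A : OffsetMatrix) (s v : ℝ) :
    ‖offsetKernel ν A s v‖ = 1 / Real.sqrt (2 * Real.pi * |A.b|) := by
  rw [offsetKernel, norm_smul, norm_mul, Quaternion.norm_exp_smul h, Quaternion.norm_exp_smul h,
    Real.norm_of_nonneg (by positivity), mul_one, mul_one]

theorem continuous_offsetKernel (h : ν * ν = -1) (A : OffsetMatrix) :
    Continuous fun z : ℝ × ℝ => offsetKernel ν A z.1 z.2 := by
  have := (Quaternion.continuous_exp_smul h).comp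
    (f := fun z : ℝ × ℝ => (A.a * z.1 ^ 2 - 2 * z.1 * (z.2 - A.τ)
      - 2 * z.2 * (A.d * A.τ - A.b * A.η) + A.d * (z.2 ^ 2 + A.τ ^ 2)) / (2 * A.b)) (by fun_prop)
  simp only [Function.comp_def] at this
  unfold offsetKernel
  fun_prop

end OffsetKernel

/-! ### The cross product of two signals. -/

section CrossProduct
open scoped ENNReal

variable {f g : ℝ × ℝ → ℍ[ℝ]}

/-- Signals are only a.e. strongly measurable, so composing them with this map requires null sets to
pull back to null sets. -/
theorem quasiMeasurePreserving_add_smul (c : ℝ) :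
    Measure.QuasiMeasurePreserving (fun z : (ℝ × ℝ) × (ℝ × ℝ) => z.1 + c • z.2)
      ((volume : Measure (ℝ × ℝ)).prod volume) volume :=
  QuasiMeasurePreserving.prod_of_left (by fun_prop) (Filter.Eventually.of_forall fun s =>
    (measurePreserving_add_right volume (c • s)).quasiMeasurePreserving)

theorem memLp_two_comp_add_smul (hf : MemLp f 2) (t : ℝ × ℝ) {c : ℝ} (hc : c ≠ 0) :
    MemLp (fun s => f (t + c • s)) 2 := by
  have qmp : Measure.QuasiMeasurePreserving (fun s : ℝ × ℝ => t + c • s) volume volume :=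
    (measurePreserving_add_left volume t).quasiMeasurePreserving.comp
      (Measure.quasiMeasurePreserving_smul volume hc)
  refine (memLp_two_iff_integrable_sq_norm (hf.1.comp_quasiMeasurePreserving qmp)).2 ?_
  exact (((memLp_two_iff_integrable_sq_norm hf.1).1 hf).comp_add_left t).comp_smul hc

theorem integral_norm_sq_comp_add_smul (f : ℝ × ℝ → ℍ[ℝ]) (t : ℝ × ℝ) (c : ℝ) :
    ∫ s, ‖f (t + c • s)‖ ^ 2 = |(c ^ 2)⁻¹| * ∫ s, ‖f s‖ ^ 2 := by
  rw [Measure.integral_comp_smul volume (fun s => ‖f (t + s)‖ ^ 2) c,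
    integral_add_left_eq_self (fun s => ‖f s‖ ^ 2) t]
  simp

theorem memLp_star_comp_sub_smul (hg : MemLp g 2) (t : ℝ × ℝ) {c : ℝ} (hc : c ≠ 0) :
    MemLp (fun s => star (g (t - c • s))) 2 := by
  have := memLp_two_comp_add_smul hg t (neg_ne_zero.2 hc)
  simp only [neg_smul, ← sub_eq_add_neg] at this
  exact this.star

theorem integrable_cross (hf : MemLp f 2) (hg : MemLp g 2) (t : ℝ × ℝ) :
    Integrable fun s : ℝ × ℝ => f (t + (1 / 2 : ℝ) • s) * star (g (t - (1 / 2 : ℝ) • s)) :=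
  (memLp_two_comp_add_smul hf t (by norm_num)).integrable_mul
    (memLp_star_comp_sub_smul hg t (by norm_num))

/-- Cauchy–Schwarz; dilation by `1 / 2` on the plane doubles each `L²` norm, whence `4`. -/
theorem integral_norm_cross_le (hf : MemLp f 2) (hg : MemLp g 2) (t : ℝ × ℝ) :
    ∫ s : ℝ × ℝ, ‖f (t + (1 / 2 : ℝ) • s) * star (g (t - (1 / 2 : ℝ) • s))‖
      ≤ 4 * (quatL2Norm f * quatL2Norm g) := by
  have h := integral_mul_norm_le_Lp_mul_Lq (μ := volume) Real.HolderConjugate.two_two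
    (f := fun s : ℝ × ℝ => f (t + (1 / 2 : ℝ) • s))
    (g := fun s : ℝ × ℝ => star (g (t - (1 / 2 : ℝ) • s)))
    (by rw [ENNReal.ofReal_ofNat]; exact memLp_two_comp_add_smul hf t (by norm_num))
    (by rw [ENNReal.ofReal_ofNat]; exact memLp_star_comp_sub_smul hg t (by norm_num))
  simp only [norm_mul]
  refine h.trans_eq ?_
  have e := integral_norm_sq_comp_add_smul g t (-(1 / 2))
  simp only [neg_smul, ← sub_eq_add_neg] at e
  simp only [norm_star, Real.rpow_two]
  rw [integral_norm_sq_comp_add_smul, e, ← Real.sqrt_eq_rpow, ← Real.sqrt_eq_rpow, Real.sqrt_mul (by positivity),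
    Real.sqrt_mul (by positivity), quatL2Norm, quatL2Norm]
  have : Real.sqrt |((1 / 2 : ℝ) ^ 2)⁻¹| = 2 := by
    rw [Real.sqrt_eq_iff_mul_self_eq (by positivity) (by norm_num)]
    norm_num
  rw [neg_sq, this]
  ring

theorem aestronglyMeasurable_cross (hf : MemLp f 2) (hg : MemLp g 2) :
    AEStronglyMeasurable (fun z : (ℝ × ℝ) × (ℝ × ℝ) =>
      f (z.1 + (1 / 2 : ℝ) • z.2) * star (g (z.1 - (1 / 2 : ℝ) • z.2)))
      ((volume : Measure (ℝ × ℝ)).prod volume) := by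
  have h1 := hf.1.comp_quasiMeasurePreserving
    (quasiMeasurePreserving_add_smul (1 / 2))
  have h2 := hg.1.comp_quasiMeasurePreserving
    (quasiMeasurePreserving_add_smul (-(1 / 2)))
  simp only [Function.comp_def, neg_smul, ← sub_eq_add_neg] at h1 h2
  exact h1.mul h2.star

/-- The substitution `(t + s/2, t - s/2)` has Jacobian of modulus `1`; it is carried out as a shift
in `t`, then a reflection in `s`. -/
theorem lintegral_enorm_sq_cross (hf : MemLp f 2) (hg : MemLp g 2) :
    ∫⁻ t : ℝ × ℝ, ∫⁻ s : ℝ × ℝ,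
        ‖f (t + (1 / 2 : ℝ) • s) * star (g (t - (1 / 2 : ℝ) • s))‖ₑ ^ 2
      = (∫⁻ x, ‖f x‖ₑ ^ 2) * ∫⁻ x, ‖g x‖ₑ ^ 2 := by
  rw [lintegral_lintegral_swap (by exact (aestronglyMeasurable_cross hf hg).enorm.pow_const 2)]
  have hstar : ∀ q : ℍ[ℝ], ‖star q‖ₑ = ‖q‖ₑ := fun q => by
    rw [← ofReal_norm, ← ofReal_norm, norm_star]
  have e : ∀ s : ℝ × ℝ, ∫⁻ t : ℝ × ℝ,
      ‖f (t + (1 / 2 : ℝ) • s) * star (g (t - (1 / 2 : ℝ) • s))‖ₑ ^ 2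
      = ∫⁻ t : ℝ × ℝ, ‖f t‖ₑ ^ 2 * ‖g (t - s)‖ₑ ^ 2 := by
    intro s
    rw [← lintegral_add_right_eq_self (fun t => ‖f t‖ₑ ^ 2 * ‖g (t - s)‖ₑ ^ 2) ((1 / 2 : ℝ) • s)]
    refine lintegral_congr fun t => ?_
    rw [enorm_mul, mul_pow, hstar]
    congr 4
    module
  simp only [e]
  rw [lintegral_lintegral_swap]
  · have e2 : ∀ t : ℝ × ℝ, ∫⁻ s : ℝ × ℝ, ‖f t‖ₑ ^ 2 * ‖g (t - s)‖ₑ ^ 2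
        = ‖f t‖ₑ ^ 2 * ∫⁻ x, ‖g x‖ₑ ^ 2 := by
      intro t
      rw [lintegral_const_mul' _ _ (by simp), lintegral_sub_left_eq_self (fun x => ‖g x‖ₑ ^ 2) t]
    simp only [e2]
    exact lintegral_mul_const'' _ (hf.1.enorm.pow_const 2)
  · have h2 := hg.1.comp_quasiMeasurePreserving
      ((quasiMeasurePreserving_add_smul (-1)).comp
        Measure.measurePreserving_swap.quasiMeasurePreserving)
    simp only [Function.comp_def, Prod.fst_swap, Prod.snd_swap, neg_smul, one_smul,
      ← sub_eq_add_neg] at h2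
    exact (hf.1.comp_snd.enorm.pow_const 2).mul (h2.enorm.pow_const 2)

theorem lintegral_enorm_sq_eq_ofReal_quatL2Norm_sq (hf : MemLp f 2) :
    ∫⁻ x, ‖f x‖ₑ ^ 2 = ENNReal.ofReal (quatL2Norm f ^ 2) := by
  rw [quatL2Norm, Real.sq_sqrt (by positivity), ofReal_integral_eq_lintegral_ofReal
    ((memLp_two_iff_integrable_sq_norm hf.1).1 hf) (Filter.Eventually.of_forall fun _ => by positivity)]
  simp only [ENNReal.ofReal_pow (norm_nonneg _), ofReal_norm]

end CrossProduct

/-! ### Sup and `L²` bounds for the distribution. -/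

section WignerVille
open scoped ENNReal

variable {lam mu : ℍ[ℝ]} {A₁ A₂ : OffsetMatrix} {f g : ℝ × ℝ → ℍ[ℝ]}

theorem integrable_wvdIntegrand (hl : lam * lam = -1) (hm : mu * mu = -1)
    (hf : MemLp f 2) (hg : MemLp g 2) (t u : ℝ × ℝ) :
    Integrable (wvdIntegrand lam mu A₁ A₂ f g t u) := by
  refine ((integrable_cross hf hg t).bdd_mul (c := 1 / Real.sqrt (2 * Real.pi * |A₁.b|))
    (Continuous.aestronglyMeasurable ?_) (Filter.Eventually.of_forall fun s => ?_)).mul_bdd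
    (c := 1 / Real.sqrt (2 * Real.pi * |A₂.b|))
    (Continuous.aestronglyMeasurable ?_) (Filter.Eventually.of_forall fun s => ?_)
  · exact (continuous_offsetKernel hl A₁).comp
      (f := fun s : ℝ × ℝ => (s.1, u.1)) (by fun_prop)
  · rw [norm_offsetKernel hl]
  · exact (continuous_offsetKernel hm A₂).comp
      (f := fun s : ℝ × ℝ => (s.2, u.2)) (by fun_prop)
  · rw [norm_offsetKernel hm]

theorem aestronglyMeasurable_wvdQOLCT (hl : lam * lam = -1) (hm : mu * mu = -1)
    (hf : MemLp f 2) (hg : MemLp g 2) :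
    AEStronglyMeasurable (fun z : (ℝ × ℝ) × (ℝ × ℝ) => wvdQOLCT lam mu A₁ A₂ f g z.1 z.2)
      volume := by
  refine AEStronglyMeasurable.integral_prod_right'
    (f := fun y : ((ℝ × ℝ) × (ℝ × ℝ)) × (ℝ × ℝ) =>
      wvdIntegrand lam mu A₁ A₂ f g y.1.1 y.1.2 y.2) ?_
  have hqmp := QuasiMeasurePreserving.prodMap
    (Measure.quasiMeasurePreserving_fst (μ := (volume : Measure (ℝ × ℝ)))
      (ν := (volume : Measure (ℝ × ℝ))))
    (Measure.QuasiMeasurePreserving.id (volume : Measure (ℝ × ℝ)))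
  have hc := (aestronglyMeasurable_cross hf hg).comp_quasiMeasurePreserving hqmp
  refine ((Continuous.aestronglyMeasurable ?_).mul hc).mul (Continuous.aestronglyMeasurable ?_)
  · exact (continuous_offsetKernel hl A₁).comp
      (f := fun y : ((ℝ × ℝ) × (ℝ × ℝ)) × (ℝ × ℝ) => (y.2.1, y.1.2.1)) (by fun_prop)
  · exact (continuous_offsetKernel hm A₂).comp
      (f := fun y : ((ℝ × ℝ) × (ℝ × ℝ)) × (ℝ × ℝ) => (y.2.2, y.1.2.2)) (by fun_prop)

theorem inv_sqrt_two_pi_mul (b₁ b₂ : ℝ) :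
    1 / Real.sqrt (2 * Real.pi * |b₁|) * (1 / Real.sqrt (2 * Real.pi * |b₂|))
      = 1 / (2 * Real.pi * Real.sqrt |b₁ * b₂|) := by
  have hpi := Real.pi_pos
  rw [div_mul_div_comm, one_mul, ← Real.sqrt_mul (by positivity),
    show 2 * Real.pi * |b₁| * (2 * Real.pi * |b₂|) = (2 * Real.pi) ^ 2 * |b₁ * b₂| by
      rw [abs_mul]; ring, Real.sqrt_mul (by positivity), Real.sqrt_sq (by positivity)]

theorem norm_wvdQOLCT_le (hl : lam * lam = -1) (hm : mu * mu = -1)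
    (hf : MemLp f 2) (hg : MemLp g 2) (t u : ℝ × ℝ) :
    ‖wvdQOLCT lam mu A₁ A₂ f g t u‖
      ≤ 4 / (2 * Real.pi * Real.sqrt |A₁.b * A₂.b|) * (quatL2Norm f * quatL2Norm g) := by
  have hpi := Real.pi_pos
  refine (norm_integral_le_integral_norm _).trans ?_
  have e : ∀ s, ‖wvdIntegrand lam mu A₁ A₂ f g t u s‖
      = 1 / (2 * Real.pi * Real.sqrt |A₁.b * A₂.b|)
        * ‖f (t + (1 / 2 : ℝ) • s) * star (g (t - (1 / 2 : ℝ) • s))‖ := by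
    intro s
    rw [wvdIntegrand, norm_mul, norm_mul _ (f _ * _), norm_offsetKernel hl, norm_offsetKernel hm,
      ← inv_sqrt_two_pi_mul]
    ring
  simp only [e]
  rw [integral_const_mul]
  refine (mul_le_mul_of_nonneg_left (integral_norm_cross_le hf hg t) (by positivity)).trans_eq ?_
  ring

theorem lintegral_enorm_sq_wvdQOLCT_snd_le (hl : lam * lam = -1) (hm : mu * mu = -1)
    (h₁ : A₁.b ≠ 0) (h₂ : A₂.b ≠ 0) (hf : MemLp f 2) (hg : MemLp g 2) (t : ℝ × ℝ) :
    ∫⁻ u, ‖wvdQOLCT lam mu A₁ A₂ f g t u‖ₑ ^ 2 ≤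
      16 * ∫⁻ s : ℝ × ℝ, ‖f (t + (1 / 2 : ℝ) • s) * star (g (t - (1 / 2 : ℝ) • s))‖ₑ ^ 2 := by
  have hpi := Real.pi_pos
  obtain ⟨κ₁, χ₁, hχ₁, hK₁⟩ := exists_offsetKernel_eq hl A₁
  obtain ⟨κ₂, χ₂, hχ₂, hK₂⟩ := exists_offsetKernel_eq hm A₂
  set h : ℝ × ℝ → ℍ[ℝ] :=
    fun s => f (t + (1 / 2 : ℝ) • s) * star (g (t - (1 / 2 : ℝ) • s)) with hh
  let k : ℝ × ℝ → ℍ[ℝ] := fun s =>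
    NormedSpace.exp (χ₁ s.1 • lam) * h s * NormedSpace.exp (χ₂ s.2 • mu)
  have hknorm : ∀ s, ‖k s‖ = ‖h s‖ := fun s => by
    simp only [k, norm_mul, Quaternion.norm_exp_smul hl, Quaternion.norm_exp_smul hm, one_mul,
      mul_one]
  have hk : Integrable k := by
    refine ((integrable_cross hf hg t).bdd_mul (c := 1) (Continuous.aestronglyMeasurable
      ((Quaternion.continuous_exp_smul hl).comp (by fun_prop)))
      (Filter.Eventually.of_forall fun s => ?_)).mul_bdd (c := 1)
      (Continuous.aestronglyMeasurable ((Quaternion.continuous_exp_smul hm).comp (by fun_prop)))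
      (Filter.Eventually.of_forall fun s => ?_)
    · exact (Quaternion.norm_exp_smul hl _).le
    · exact (Quaternion.norm_exp_smul hm _).le
  let I : ℝ × ℝ → ℝ × ℝ → ℍ[ℝ] := fun u s =>
    NormedSpace.exp ((-(s.1 * u.1 / A₁.b)) • lam) * k s *
      NormedSpace.exp ((-(s.2 * u.2 / A₂.b)) • mu)
  have hI : ∀ u, Integrable (I u) := by
    intro u
    refine (hk.bdd_mul (c := 1) (Continuous.aestronglyMeasurable
      ((Quaternion.continuous_exp_smul hl).comp (by fun_prop)))
      (Filter.Eventually.of_forall fun s => ?_)).mul_bdd (c := 1)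
      (Continuous.aestronglyMeasurable ((Quaternion.continuous_exp_smul hm).comp (by fun_prop)))
      (Filter.Eventually.of_forall fun s => ?_)
    · exact (Quaternion.norm_exp_smul hl _).le
    · exact (Quaternion.norm_exp_smul hm _).le
  set r : ℝ := 1 / (2 * Real.pi * Real.sqrt |A₁.b * A₂.b|) with hr
  have hW : ∀ u, wvdQOLCT lam mu A₁ A₂ f g t u = r •
      (NormedSpace.exp (κ₁ u.1 • lam) * (∫ s, I u s) * NormedSpace.exp (κ₂ u.2 • mu)) := by
    intro u
    rw [← integral_const_mul_of_integrable (hI u),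
      ← integral_mul_const_of_integrable ((hI u).const_mul _), ← integral_smul]
    refine integral_congr_ae (Filter.Eventually.of_forall fun s => ?_)
    -- Exponentials in `mu` commute, so the right kernel can be reordered with its `s`-chirp next to
    -- `h` and its `u`-chirp outermost.
    have c1 := Quaternion.exp_add_smul hm (χ₂ s.2) (-(s.2 * u.2 / A₂.b))
    rw [add_comm, Quaternion.exp_add_smul hm] at c1
    have c2 := Quaternion.exp_add_smul hm (κ₂ u.2)
      (-(s.2 * u.2 / A₂.b) + χ₂ s.2)
    rw [add_comm, Quaternion.exp_add_smul hm, Quaternion.exp_add_smul hm, c1] at c2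
    simp only [wvdIntegrand, hK₁ h₁, hK₂ h₂, smul_mul_assoc, mul_smul_comm, smul_smul, I, k, hr,
      ← inv_sqrt_two_pi_mul]
    rw [mul_comm (1 / Real.sqrt (2 * Real.pi * |A₂.b|)), mul_assoc (NormedSpace.exp (κ₂ u.2 • mu)),
      c1, ← c2]
    simp only [hh, mul_assoc]
  have hWn : ∀ u, ‖wvdQOLCT lam mu A₁ A₂ f g t u‖ₑ ^ 2
      = ENNReal.ofReal (r ^ 2) * ‖∫ s, I u s‖ₑ ^ 2 := by
    intro u
    rw [hW u, ← ofReal_norm, ← ofReal_norm, norm_smul, norm_mul, norm_mul,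
      Quaternion.norm_exp_smul hl, Quaternion.norm_exp_smul hm, one_mul, mul_one,
      ← ENNReal.ofReal_pow (by positivity), ← ENNReal.ofReal_pow (by positivity),
      ← ENNReal.ofReal_mul (by positivity), mul_pow, Real.norm_eq_abs, sq_abs]
  simp only [hWn]
  rw [lintegral_const_mul' _ _ ENNReal.ofReal_ne_top]
  refine (mul_le_mul_right
    (lintegral_enorm_sq_two_sided_quaternion_fourier_le hl hm h₁ h₂ hk) _).trans_eq ?_
  rw [← mul_assoc, ← ENNReal.ofReal_mul (by positivity)]
  congr 1
  -- `r ^ 2` cancels `4 π² |b₁ b₂|` out of `64 π² |b₁ b₂|`, leaving `16`.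
  · rw [hr, div_pow, mul_pow, Real.sq_sqrt (abs_nonneg _), ← ENNReal.ofReal_ofNat]
    congr 1
    field_simp
    norm_num
  · refine lintegral_congr fun s => ?_
    rw [← ofReal_norm, hknorm, ofReal_norm]

theorem lintegral_enorm_sq_wvdQOLCT_le (hl : lam * lam = -1) (hm : mu * mu = -1)
    (h₁ : A₁.b ≠ 0) (h₂ : A₂.b ≠ 0) (hf : MemLp f 2) (hg : MemLp g 2) :
    ∫⁻ z : (ℝ × ℝ) × (ℝ × ℝ), ‖wvdQOLCT lam mu A₁ A₂ f g z.1 z.2‖ₑ ^ 2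
      ≤ ENNReal.ofReal (16 * (quatL2Norm f * quatL2Norm g) ^ 2) := by
  rw [Measure.volume_eq_prod, lintegral_prod _
    ((aestronglyMeasurable_wvdQOLCT hl hm hf hg).enorm.pow_const 2)]
  refine (lintegral_mono fun t =>
    lintegral_enorm_sq_wvdQOLCT_snd_le hl hm h₁ h₂ hf hg t).trans_eq ?_
  rw [lintegral_const_mul' _ _ (by norm_num), lintegral_enorm_sq_cross hf hg,
    lintegral_enorm_sq_eq_ofReal_quatL2Norm_sq hf, lintegral_enorm_sq_eq_ofReal_quatL2Norm_sq hg,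
    mul_pow, ENNReal.ofReal_mul (by norm_num), ENNReal.ofReal_mul (by positivity),
    ENNReal.ofReal_ofNat]

theorem integrable_norm_sq_wvdQOLCT (hl : lam * lam = -1) (hm : mu * mu = -1)
    (h₁ : A₁.b ≠ 0) (h₂ : A₂.b ≠ 0) (hf : MemLp f 2) (hg : MemLp g 2) :
    Integrable (fun z : (ℝ × ℝ) × (ℝ × ℝ) => ‖wvdQOLCT lam mu A₁ A₂ f g z.1 z.2‖ ^ 2) := by
  refine ⟨(aestronglyMeasurable_wvdQOLCT hl hm hf hg).norm.pow 2, ?_⟩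
  refine lt_of_le_of_lt ?_ ((lintegral_enorm_sq_wvdQOLCT_le hl hm h₁ h₂ hf hg).trans_lt
    ENNReal.ofReal_lt_top)
  simp

theorem integral_norm_sq_wvdQOLCT_le (hl : lam * lam = -1) (hm : mu * mu = -1)
    (h₁ : A₁.b ≠ 0) (h₂ : A₂.b ≠ 0) (hf : MemLp f 2) (hg : MemLp g 2) :
    ∫ z : (ℝ × ℝ) × (ℝ × ℝ), ‖wvdQOLCT lam mu A₁ A₂ f g z.1 z.2‖ ^ 2
      ≤ 16 * (quatL2Norm f * quatL2Norm g) ^ 2 := by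
  rw [← ENNReal.ofReal_le_ofReal_iff (by positivity), ofReal_integral_eq_lintegral_ofReal
    (integrable_norm_sq_wvdQOLCT hl hm h₁ h₂ hf hg)
    (Filter.Eventually.of_forall fun _ => by positivity)]
  simpa only [ENNReal.ofReal_pow (norm_nonneg _), ofReal_norm] using
    lintegral_enorm_sq_wvdQOLCT_le hl hm h₁ h₂ hf hg

theorem quatL2Norm_nonneg (f : ℝ × ℝ → ℍ[ℝ]) : 0 ≤ quatL2Norm f := Real.sqrt_nonneg _

theorem rpow_sub_two_mul_sq {p x : ℝ} (hp : 2 ≤ p) (hx : 0 ≤ x) : x ^ (p - 2) * x ^ 2 = x ^ p := by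
  rw [← Real.rpow_two, ← Real.rpow_add_of_nonneg hx (by linarith) (by norm_num), sub_add_cancel]

end WignerVille

/-! ### Interpolation between the two bounds. -/

theorem mainTheorem4 (p : ℝ) (hp : 2 ≤ p) :
    ∃ C : ℝ, 0 < C ∧
      ∀ (lam mu : ℍ[ℝ]), lam ^ 2 = -1 → mu ^ 2 = -1 →
      ∀ (A₁ A₂ : OffsetMatrix), A₁.b ≠ 0 → A₂.b ≠ 0 →
      ∀ (f g : ℝ × ℝ → ℍ[ℝ]), MemLp f 2 volume → MemLp g 2 volume →
        (∀ t u : ℝ × ℝ, Integrable (wvdIntegrand lam mu A₁ A₂ f g t u) volume) ∧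
        Integrable (fun z : (ℝ × ℝ) × (ℝ × ℝ) => ‖wvdQOLCT lam mu A₁ A₂ f g z.1 z.2‖ ^ p) volume ∧
        ∫ t : ℝ × ℝ, ∫ u : ℝ × ℝ, ‖wvdQOLCT lam mu A₁ A₂ f g t u‖ ^ p
          ≤ C * (|A₁.b * A₂.b| ^ (-p / 2 + 1) / (2 * Real.pi) ^ p)
              * quatL2Norm f ^ p * quatL2Norm g ^ p := by
  have hpi := Real.pi_pos
  -- `4 ^ (p - 2)` from the sup bound times `16` from the `L²` bound is `4 ^ p`; the factor `(2π) ^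
  -- 2` compensates for the sup bound giving only `(2π) ^ (-(p - 2))`.
  refine ⟨4 ^ p * (2 * Real.pi) ^ 2, by positivity, ?_⟩
  intro lam mu hl hm A₁ A₂ h₁ h₂ f g hf hg
  rw [sq] at hl hm
  have hN : 0 ≤ quatL2Norm f * quatL2Norm g :=
    mul_nonneg (quatL2Norm_nonneg f) (quatL2Norm_nonneg g)
  have hb : 0 < |A₁.b * A₂.b| := abs_pos.2 (mul_ne_zero h₁ h₂)
  set N := quatL2Norm f * quatL2Norm g with hNdef
  set M := 4 / (2 * Real.pi * Real.sqrt |A₁.b * A₂.b|) * N with hM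
  have hle : ∀ z : (ℝ × ℝ) × (ℝ × ℝ), ‖wvdQOLCT lam mu A₁ A₂ f g z.1 z.2‖ ^ p
      ≤ M ^ (p - 2) * ‖wvdQOLCT lam mu A₁ A₂ f g z.1 z.2‖ ^ 2 := by
    intro z
    rw [← rpow_sub_two_mul_sq hp (norm_nonneg _)]
    exact mul_le_mul_of_nonneg_right (Real.rpow_le_rpow (norm_nonneg _)
      (norm_wvdQOLCT_le hl hm hf hg _ _) (by linarith)) (by positivity)
  have hI2 := (integrable_norm_sq_wvdQOLCT hl hm h₁ h₂ hf hg).const_mul (M ^ (p - 2))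
  have hI : Integrable (fun z : (ℝ × ℝ) × (ℝ × ℝ) =>
      ‖wvdQOLCT lam mu A₁ A₂ f g z.1 z.2‖ ^ p) volume := by
    refine hI2.mono' ((Real.continuous_rpow_const (by linarith)).comp_aestronglyMeasurable
      (aestronglyMeasurable_wvdQOLCT hl hm hf hg).norm) (Filter.Eventually.of_forall fun z => ?_)
    rw [Real.norm_of_nonneg (by positivity)]
    exact hle z
  refine ⟨fun t u => integrable_wvdIntegrand hl hm hf hg t u, hI, ?_⟩
  rw [integral_integral (by exact hI)]
  refine (integral_mono hI hI2 hle).trans ?_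
  rw [integral_const_mul]
  refine (mul_le_mul_of_nonneg_left (integral_norm_sq_wvdQOLCT_le hl hm h₁ h₂ hf hg)
    (by positivity)).trans_eq ?_
  rw [← hNdef, hM, mul_assoc _ (quatL2Norm f ^ p), ← Real.mul_rpow (quatL2Norm_nonneg f)
    (quatL2Norm_nonneg g), ← hNdef, ← rpow_sub_two_mul_sq hp hN, Real.mul_rpow (by positivity) hN,
    Real.div_rpow (by norm_num) (by positivity), Real.mul_rpow (by positivity) (by positivity),
    ← rpow_sub_two_mul_sq hp (by norm_num : (0 : ℝ) ≤ 4),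
    ← rpow_sub_two_mul_sq hp (by positivity : 0 ≤ 2 * Real.pi), Real.sqrt_eq_rpow,
    ← Real.rpow_mul hb.le, show -p / 2 + 1 = -(1 / 2 * (p - 2)) by ring, Real.rpow_neg hb.le]
  field_simp
  norm_num
  ring
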